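/- Let $n\in\{2,3\}$, $Q=(0,1)^n$, and let $Q_1,Q_2\subset Q$ be disjoint open sets of positive measure with $Q=Q_1\cup Q_2\cup\Gamma$, $\Gamma=\overline{Q_1}\cap\overline{Q_2}$, and $\overline{Q_2}\subset Q$. Assume that the $Q$-periodic extensions of $Q_1$ and $Q_2$ (as open subsets of $\mathbb{R}^n$) have $C^1$ boundaries and lie locally on one side of them, that the extension of $Q_1$ is connected, and that $Q_1$ is connected with Lipschitz boundary. Let $\mu_1>0$, let $\chi_2$ be the characteristic function of $Q_2$, let $e(\mathbf u)=\frac12(\nabla\mathbf u+\nabla^T\mathbf u)$ and $A:B=\sum_{i,j}A_{ij}B_{ij}$. Let $H(Q)$ be the space of complex vector fields $\mathbf v\in H^1(Q_1\cup Q_2)^n$ such that $\operatorname{div}\mathbf v=0$, $\mathbf v\cdot\mathbf n=0$ in $H^{-1/2}(\Gamma)$, the jump of $\mathbf v$ across $\Gamma$ is zero, $(\mathbf v,\boldsymbol\eta)_{H^1(Q_2)}=0$ for every rigid displacement $\boldsymbol\eta(\mathbf y)=A\mathbf y+\mathbf b$ with $A$ skew-symmetric, and $\mathbf v$ is $Q$-periodic.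 Endow $H(Q)$ with $$(\mathbf u,\mathbf v)_Q=\int_Q 2\mu_1\,e(\mathbf u):\overline{e(\mathbf v)}\,d\mathbf y,\qquad \|\mathbf u\|_Q^2=(\mathbf u,\mathbf u)_Q .$$ **Proposition.** The form $(\cdot,\cdot)_Q$ is an inner product that makes $H(Q)$ a Hilbert space, and there is exactly one map $\Gamma_\chi:H(Q)\to H(Q)$ with $$(\Gamma_\chi\mathbf u,\mathbf v)_Q=\int_Q 2\mu_1\chi_2\,e(\mathbf u):\overline{e(\mathbf v)}\,d\mathbf y\qquad\text{for all }\mathbf u,\mathbf v\in H(Q).$$ This $\Gamma_\chi$ is a bounded linear operator on $H(Q)$. It is self-adjoint, $(\Gamma_\chi\mathbf u,\mathbf v)_Q=(\mathbf u,\Gamma_\chi\mathbf v)_Q$ for all $\mathbf u,\mathbf v\in H(Q)$; it is positive, $(\Gamma_\chi\mathbf u,\mathbf u)_Q\ge 0$ for all $\mathbf u\in H(Q)$; and $\|\Gamma_\chi\|\le 1$. -/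

import Mathlib

open MeasureTheory Set Filter Topology
open scoped ContDiff ENNReal ComplexConjugate

noncomputable section

namespace TwoFluid

/-! ### Geometry of the periodic cell -/

/-- Points of `ℝⁿ`, with the Euclidean norm. -/
abbrev Pt (n : ℕ) : Type := EuclideanSpace ℝ (Fin n)

/-- The open unit cell `Q = (0,1)ⁿ`. -/
def unitCell (n : ℕ) : Set (Pt n) := {y | ∀ i, y i ∈ Ioo (0 : ℝ) 1}

/-- The `Q`-periodic extension of `A ⊆ Q`, as an open subset of `ℝⁿ`: the interior of the closure of
the union of all integer translates of `A`. (Taking the interior of the closure fills in the faces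
between adjacent translated cells, which belong to no translate of the open cell.) -/
def periodicExtension {n : ℕ} (A : Set (Pt n)) : Set (Pt n) :=
  interior (closure {y | ∃ k : Fin n → ℤ, ∃ a ∈ A, ∀ i, y i = a i + (k i : ℝ)})

/-- Near each of its boundary points, `Ω` is the region strictly below the graph of a function `g`
with property `reg`, in the direction of some unit vector `ν`. (The function `g` of the variables
orthogonal to `ν` is written as a function on `ℝⁿ` which is constant in the direction `ν`.)
In particular `Ω` lies locally on one side of its boundary. -/
def HasGraphBoundary {n : ℕ} (reg : (Pt n → ℝ) → Prop) (Ω : Set (Pt n)) : Prop :=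
  ∀ x ∈ frontier Ω, ∃ U ∈ 𝓝 x, ∃ (ν : Pt n) (g : Pt n → ℝ), ‖ν‖ = 1 ∧ reg g ∧
    (∀ (y : Pt n) (t : ℝ), g (y + t • ν) = g y) ∧
    Ω ∩ U = {y ∈ U | inner ℝ ν y < g y}

/-- `Ω` has a `C¹` boundary and lies locally on one side of it. -/
def HasC1Boundary {n : ℕ} (Ω : Set (Pt n)) : Prop := HasGraphBoundary (ContDiff ℝ 1) Ω

/-- `Ω` has a Lipschitz boundary. -/
def HasLipschitzBoundary {n : ℕ} (Ω : Set (Pt n)) : Prop :=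
  HasGraphBoundary (fun g => ∃ K, LipschitzWith K g) Ω

/-- A periodic two-fluid cell: the unit cell is made of the host region `Q₁`, the inclusion `Q₂` and
the interface `Γ = cl Q₁ ∩ cl Q₂`; the viscosity of the host fluid is `μ₁ > 0`. -/
structure Cell (n : ℕ) where
  Q₁ : Set (Pt n)
  Q₂ : Set (Pt n)
  μ₁ : ℝ
  μ₁_pos : 0 < μ₁
  isOpen₁ : IsOpen Q₁
  isOpen₂ : IsOpen Q₂
  disjoint : Disjoint Q₁ Q₂
  subset₁ : Q₁ ⊆ unitCell n
  cover : unitCell n = Q₁ ∪ Q₂ ∪ (closure Q₁ ∩ closure Q₂)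
  /-- `Q₂` is an inclusion: it stays away from the boundary of the cell. -/
  inclusion : closure Q₂ ⊆ unitCell n
  volume_pos₁ : 0 < volume Q₁
  volume_pos₂ : 0 < volume Q₂
  c1Boundary₁ : HasC1Boundary (periodicExtension Q₁)
  c1Boundary₂ : HasC1Boundary (periodicExtension Q₂)
  connected_ext₁ : IsConnected (periodicExtension Q₁)
  connected₁ : IsConnected Q₁
  lipschitz₁ : HasLipschitzBoundary Q₁

/-! ### Weak derivatives and boundary values in the sense of Green's formula -/

/-- The partial derivative `∂ⱼ φ`. -/
def partialDeriv {n : ℕ} (j : Fin n) (φ : Pt n → ℂ) (y : Pt n) : ℂ :=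
  fderiv ℝ φ y (EuclideanSpace.single j 1)

/-- Test functions `φ ∈ C_c^∞(U)`. -/
def IsTestFunction {n : ℕ} (U : Set (Pt n)) (φ : Pt n → ℂ) : Prop :=
  ContDiff ℝ ∞ φ ∧ HasCompactSupport φ ∧ tsupport φ ⊆ U

/-- Smooth functions on `ℝⁿ` that are `Q`-periodic. -/
def IsPeriodicSmooth {n : ℕ} (φ : Pt n → ℂ) : Prop :=
  ContDiff ℝ ∞ φ ∧ ∀ (i : Fin n) (y : Pt n), φ (y + EuclideanSpace.single i 1) = φ y

/-- `g` is the weak partial derivative `∂ⱼ f` on the open set `U`. -/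
def HasWeakPartial {n : ℕ} (U : Set (Pt n)) (j : Fin n) (f g : Pt n → ℂ) : Prop :=
  ∀ φ, IsTestFunction U φ → ∫ y in U, f y * partialDeriv j φ y = -∫ y in U, g y * φ y

/-- `φ ∈ H¹(U)` with weak gradient `ψ`. -/
def IsH1 {n : ℕ} (U : Set (Pt n)) (φ : Pt n → ℂ) (ψ : Fin n → Pt n → ℂ) : Prop :=
  MemLp φ 2 (volume.restrict U) ∧
    ∀ j, MemLp (ψ j) 2 (volume.restrict U) ∧ HasWeakPartial U j φ (ψ j)

/-- For `f ∈ H¹(U)` with `g = ∂ⱼ f` and a test function `φ`, with `ψ = ∂ⱼ φ`, Green's formula says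
that this number is the boundary integral `∫_{∂U} f nⱼ φ dS`, where `n` is the outward unit normal
of `U`. It thus determines the trace of `f` on the boundary of `U`. -/
def boundaryPairing {n : ℕ} (U : Set (Pt n)) (f g φ ψ : Pt n → ℂ) : ℂ :=
  (∫ y in U, f y * ψ y) + ∫ y in U, g y * φ y

/-! ### The space `H(Q)` -/

variable {n : ℕ}

/-- `L²(Q₁ ∪ Q₂)` with complex values. -/
abbrev L2 (C : Cell n) : Type := Lp ℂ 2 (volume.restrict (C.Q₁ ∪ C.Q₂))

/-- `v` is an element of `H(Q)`, with gradient `G i j = ∂ⱼ vᵢ`. -/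
structure IsAdmissible (C : Cell n) (v : Fin n → L2 C) (G : Fin n → Fin n → L2 C) : Prop where
  /-- `v ∈ H¹(Q₁ ∪ Q₂)ⁿ`, with weak gradient `G`. -/
  weak_gradient : ∀ i j, HasWeakPartial (C.Q₁ ∪ C.Q₂) j (v i) (G i j)
  /-- `div v = 0`. -/
  div_free : ∑ i, G i i = 0
  /-- `v · n = 0` in `H^{-1/2}(Γ)`, `Γ = ∂Q₂`: the normal trace of `v` from `Q₂`, as a functional on
  the traces of functions `φ ∈ H¹(Q₂)`, is zero. -/
  normal_trace : ∀ φ ψ, IsH1 C.Q₂ φ ψ →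
    ∑ i, boundaryPairing C.Q₂ (v i) (G i i) φ (ψ i) = 0
  /-- `⟦v⟧ = 0` on `Γ`: the traces of `v` from `Q₁` and `Q₂` agree, i.e. the boundary integrals
  `∫_Γ vᵢ nⱼ φ dS` from the two sides, with opposite outward normals, cancel. -/
  jump : ∀ i j φ, IsTestFunction (unitCell n) φ →
    boundaryPairing C.Q₁ (v i) (G i j) φ (partialDeriv j φ) +
      boundaryPairing C.Q₂ (v i) (G i j) φ (partialDeriv j φ) = 0
  /-- `(v, η)_{H¹(Q₂)} = 0` for all rigid displacements `η(y) = A y + b`, `A` skew-symmetric. -/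
  orthogonal_rigid : ∀ (A : Matrix (Fin n) (Fin n) ℂ) (b : Fin n → ℂ), A.transpose = -A →
    (∑ i, ∫ y in C.Q₂, v i y * conj ((∑ j, A i j * (y j : ℂ)) + b i)) +
      (∑ i, ∑ j, ∫ y in C.Q₂, G i j y * conj (A i j)) = 0
  /-- `v` is `Q`-periodic: its traces on opposite faces of `Q` agree, i.e. the boundary integrals
  `∫_{∂Q} vᵢ nⱼ φ dS` against periodic `φ` vanish. -/
  periodic : ∀ i j φ, IsPeriodicSmooth φ →
    boundaryPairing (C.Q₁ ∪ C.Q₂) (v i) (G i j) φ (partialDeriv j φ) = 0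

section lemmas

variable {C : Cell n} {U : Set (Pt n)}

theorem integrable_mul (hU : U ⊆ C.Q₁ ∪ C.Q₂) (f : L2 C) {g : Pt n → ℂ}
    (hg : MemLp g 2 (volume.restrict U)) :
    Integrable (fun y => f y * g y) (volume.restrict U) :=
  ((Lp.memLp f).mono_measure (Measure.restrict_mono_set _ hU)).integrable_mul hg

theorem integral_add_mul (hU : U ⊆ C.Q₁ ∪ C.Q₂) (f f' : L2 C) {g : Pt n → ℂ}
    (hg : MemLp g 2 (volume.restrict U)) :
    ∫ y in U, (f + f' : L2 C) y * g y = (∫ y in U, f y * g y) + ∫ y in U, f' y * g y := by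
  rw [← integral_add (integrable_mul hU f hg) (integrable_mul hU f' hg)]
  refine integral_congr_ae ?_
  filter_upwards [ae_mono (Measure.restrict_mono_set _ hU) (Lp.coeFn_add f f')] with y hy
  rw [hy, Pi.add_apply, add_mul]

theorem integral_smul_mul (hU : U ⊆ C.Q₁ ∪ C.Q₂) (c : ℂ) (f : L2 C) (g : Pt n → ℂ) :
    ∫ y in U, (c • f : L2 C) y * g y = c * ∫ y in U, f y * g y := by
  rw [← integral_const_mul]
  refine integral_congr_ae ?_
  filter_upwards [ae_mono (Measure.restrict_mono_set _ hU) (Lp.coeFn_smul c f)] with y hy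
  rw [hy, Pi.smul_apply, smul_eq_mul, mul_assoc]

theorem boundaryPairing_add (hU : U ⊆ C.Q₁ ∪ C.Q₂) (f f' g g' : L2 C) {φ ψ : Pt n → ℂ}
    (hφ : MemLp φ 2 (volume.restrict U)) (hψ : MemLp ψ 2 (volume.restrict U)) :
    boundaryPairing U (f + f' : L2 C) (g + g' : L2 C) φ ψ =
      boundaryPairing U f g φ ψ + boundaryPairing U f' g' φ ψ := by
  unfold boundaryPairing
  rw [integral_add_mul hU _ _ hψ, integral_add_mul hU _ _ hφ]
  ring

theorem boundaryPairing_smul (hU : U ⊆ C.Q₁ ∪ C.Q₂) (c : ℂ) (f g : L2 C) (φ ψ : Pt n → ℂ) :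
    boundaryPairing U (c • f : L2 C) (c • g : L2 C) φ ψ = c * boundaryPairing U f g φ ψ := by
  unfold boundaryPairing
  rw [integral_smul_mul hU, integral_smul_mul hU]
  ring

theorem Cell.subset₂ (C : Cell n) : C.Q₂ ⊆ unitCell n := subset_closure.trans C.inclusion

/-- A continuous function is square integrable on subsets of the cell. -/
theorem memLp_of_continuous (hU : U ⊆ C.Q₁ ∪ C.Q₂) {g : Pt n → ℂ} (hg : Continuous g) :
    MemLp g 2 (volume.restrict U) := by
  let K : Set (Pt n) := {y | ∀ i, y i ∈ Icc (0 : ℝ) 1}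
  have hK : IsCompact K := by
    have h := (isCompact_univ_pi (fun _ : Fin n => isCompact_Icc (a := (0 : ℝ)) (b := 1))).image
      (PiLp.continuous_toLp 2 (fun _ : Fin n => ℝ))
    convert h using 1
    ext y
    constructor
    · intro hy
      exact ⟨fun i => y i, fun i _ => hy i, rfl⟩
    · rintro ⟨z, hz, rfl⟩ i
      exact hz i (mem_univ i)
  have hUK : U ⊆ K := fun y hy i =>
    Ioo_subset_Icc_self ((union_subset C.subset₁ C.subset₂ (hU hy)) i)
  have hfin : IsFiniteMeasure (volume.restrict U) :=
    ⟨by rw [Measure.restrict_apply_univ]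
        exact (measure_mono hUK).trans_lt hK.measure_lt_top⟩
  obtain ⟨M, hM⟩ := hK.exists_bound_of_continuousOn hg.continuousOn
  refine MemLp.of_bound hg.aestronglyMeasurable M ?_
  have h : ∀ᵐ y ∂(volume.restrict K), ‖g y‖ ≤ M :=
    (ae_restrict_iff' hK.measurableSet).2 (Eventually.of_forall hM)
  exact ae_mono (Measure.restrict_mono_set _ hUK) h

theorem continuous_partialDeriv {φ : Pt n → ℂ} (hφ : ContDiff ℝ ∞ φ) (j : Fin n) :
    Continuous (partialDeriv j φ) :=
  (hφ.continuous_fderiv (by simp)).clm_apply continuous_const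

end lemmas

/-- The space of pairs `(v, ∇v)` with `v ∈ H(Q)`. The gradient is determined by `v`, see
`Space.ext_velocity` below, so this is the same as the space of all `v ∈ H(Q)`. -/
def admissible (C : Cell n) :
    Submodule ℂ ((Fin n → L2 C) × (Fin n → Fin n → L2 C)) where
  carrier := {p | IsAdmissible C p.1 p.2}
  zero_mem' := by
    have h1 : C.Q₁ ⊆ C.Q₁ ∪ C.Q₂ := subset_union_left
    have h2 : C.Q₂ ⊆ C.Q₁ ∪ C.Q₂ := subset_union_right
    have key : ∀ (U : Set (Pt n)), U ⊆ C.Q₁ ∪ C.Q₂ → ∀ g : Pt n → ℂ,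
        ∫ y in U, (0 : L2 C) y * g y = 0 := by
      intro U hU g
      have h := integral_smul_mul hU 0 (0 : L2 C) g
      rwa [zero_smul, zero_mul] at h
    have kb : ∀ (U : Set (Pt n)), U ⊆ C.Q₁ ∪ C.Q₂ → ∀ φ ψ : Pt n → ℂ,
        boundaryPairing U (0 : L2 C) (0 : L2 C) φ ψ = 0 := by
      intro U hU φ ψ
      rw [boundaryPairing, key U hU, key U hU, add_zero]
    constructor
    · intro i j φ _
      exact (key _ Subset.rfl _).trans (by rw [← neg_zero]; exact congrArg _ (key _ Subset.rfl _).symm)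
    · exact Finset.sum_eq_zero fun i _ => rfl
    · intro φ ψ _
      exact Finset.sum_eq_zero fun i _ => kb _ h2 _ _
    · intro i j φ _
      exact (congrArg₂ (· + ·) (kb _ h1 _ _) (kb _ h2 _ _)).trans (add_zero 0)
    · intro A b _
      exact (congrArg₂ (· + ·) (Finset.sum_eq_zero fun i _ => key _ h2 _)
        (Finset.sum_eq_zero fun i _ => Finset.sum_eq_zero fun j _ => key _ h2 _)).trans (add_zero 0)
    · intro i j φ _
      exact kb _ Subset.rfl _ _
  add_mem' := by
    rintro ⟨v, G⟩ ⟨v', G'⟩ h h'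
    have h1 : C.Q₁ ⊆ C.Q₁ ∪ C.Q₂ := subset_union_left
    have h2 : C.Q₂ ⊆ C.Q₁ ∪ C.Q₂ := subset_union_right
    constructor
    · intro i j φ hφ
      have e := h.weak_gradient i j φ hφ
      have e' := h'.weak_gradient i j φ hφ
      have a := integral_add_mul Subset.rfl (v i) (v' i)
        (memLp_of_continuous (C := C) Subset.rfl (continuous_partialDeriv hφ.1 j))
      have a' := integral_add_mul Subset.rfl (G i j) (G' i j)
        (memLp_of_continuous (C := C) Subset.rfl hφ.1.continuous)
      simp only [Prod.mk_add_mk, Pi.add_apply] at *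
      rw [a, a', e, e']
      ring
    · have e := h.div_free
      have e' := h'.div_free
      simp only [Prod.mk_add_mk, Pi.add_apply] at *
      rw [Finset.sum_add_distrib, e, e', add_zero]
    · intro φ ψ hφ
      have e := h.normal_trace φ ψ hφ
      have e' := h'.normal_trace φ ψ hφ
      simp only [Prod.mk_add_mk, Pi.add_apply] at *
      simp_rw [fun i => boundaryPairing_add h2 (v i) (v' i) (G i i) (G' i i) hφ.1 (hφ.2 i).1]
      rw [Finset.sum_add_distrib, e, e', add_zero]
    · intro i j φ hφ
      have e := h.jump i j φ hφ
      have e' := h'.jump i j φ hφ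
      have hc := hφ.1.continuous
      have hd := continuous_partialDeriv hφ.1 j
      have a₁ := boundaryPairing_add h1 (v i) (v' i) (G i j) (G' i j)
        (memLp_of_continuous h1 hc) (memLp_of_continuous h1 hd)
      have a₂ := boundaryPairing_add h2 (v i) (v' i) (G i j) (G' i j)
        (memLp_of_continuous h2 hc) (memLp_of_continuous h2 hd)
      simp only [Prod.mk_add_mk, Pi.add_apply] at *
      rw [a₁, a₂]
      linear_combination e + e'
    · intro A b hA
      have e := h.orthogonal_rigid A b hA
      have e' := h'.orthogonal_rigid A b hA
      have hη : ∀ i, Continuous fun y : Pt n => conj ((∑ j, A i j * (y j : ℂ)) + b i) := by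
        intro i
        fun_prop
      have a := fun i => integral_add_mul h2 (v i) (v' i) (memLp_of_continuous h2 (hη i))
      have a' := fun i j => integral_add_mul h2 (G i j) (G' i j)
        (memLp_of_continuous h2 (continuous_const (y := conj (A i j))))
      simp only [Prod.mk_add_mk, Pi.add_apply] at *
      simp only [a, a', Finset.sum_add_distrib]
      linear_combination e + e'
    · intro i j φ hφ
      have e := h.periodic i j φ hφ
      have e' := h'.periodic i j φ hφ
      have a := boundaryPairing_add Subset.rfl (v i) (v' i) (G i j) (G' i j)
        (memLp_of_continuous (C := C) Subset.rfl hφ.1.continuous)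
        (memLp_of_continuous (C := C) Subset.rfl (continuous_partialDeriv hφ.1 j))
      simp only [Prod.mk_add_mk, Pi.add_apply] at *
      rw [a, e, e', add_zero]
  smul_mem' := by
    rintro c ⟨v, G⟩ h
    have h1 : C.Q₁ ⊆ C.Q₁ ∪ C.Q₂ := subset_union_left
    have h2 : C.Q₂ ⊆ C.Q₁ ∪ C.Q₂ := subset_union_right
    constructor
    · intro i j φ hφ
      have e := h.weak_gradient i j φ hφ
      simp only [Prod.smul_mk, Pi.smul_apply, integral_smul_mul Subset.rfl] at *
      rw [e]
      ring
    · have e := h.div_free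
      simp only [Prod.smul_mk, Pi.smul_apply] at *
      rw [← Finset.smul_sum, e, smul_zero]
    · intro φ ψ hφ
      have e := h.normal_trace φ ψ hφ
      simp only [Prod.smul_mk, Pi.smul_apply, boundaryPairing_smul h2] at *
      rw [← Finset.mul_sum, e, mul_zero]
    · intro i j φ hφ
      have e := h.jump i j φ hφ
      simp only [Prod.smul_mk, Pi.smul_apply, boundaryPairing_smul h2,
        boundaryPairing_smul h1] at *
      rw [← mul_add, e, mul_zero]
    · intro A b hA
      have e := h.orthogonal_rigid A b hA
      simp only [Prod.smul_mk, Pi.smul_apply, integral_smul_mul h2] at *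
      simp only [← Finset.mul_sum]
      rw [← mul_add, e, mul_zero]
    · intro i j φ hφ
      have e := h.periodic i j φ hφ
      simp only [Prod.smul_mk, Pi.smul_apply, boundaryPairing_smul Subset.rfl] at *
      rw [e, mul_zero]

/-- The space `H(Q)`. -/
def Space (C : Cell n) : Type := admissible C

instance (C : Cell n) : AddCommGroup (Space C) := inferInstanceAs (AddCommGroup (admissible C))
instance (C : Cell n) : Module ℂ (Space C) := inferInstanceAs (Module ℂ (admissible C))

namespace Space

variable {C : Cell n}

/-- The components `vᵢ` of `v ∈ H(Q)`. -/
def velocity (v : Space C) (i : Fin n) : L2 C := v.1.1 i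

/-- The weak derivatives `∂ⱼ vᵢ` of `v ∈ H(Q)`. -/
def grad (v : Space C) (i j : Fin n) : L2 C := v.1.2 i j

/-- The components of the symmetric gradient `e(v) = (∇v + ∇ᵀv) / 2`. -/
def symGrad (v : Space C) (i j : Fin n) : L2 C := (1 / 2 : ℂ) • (v.grad i j + v.grad j i)

/-- The Frobenius product `e(u) : conj (e(v))`, as a function on `Q₁ ∪ Q₂`. -/
def frob (u v : Space C) (y : Pt n) : ℂ := ∑ i, ∑ j, u.symGrad i j y * conj (v.symGrad i j y)

/-- The inner product `(u, v)_Q = ∫_Q 2 μ₁ e(u) : conj (e(v))` of `H(Q)`, linear in `u`.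
(The interface `Γ` is a null set.) -/
def form (u v : Space C) : ℂ := ∫ y in C.Q₁ ∪ C.Q₂, 2 * (C.μ₁ : ℂ) * frob u v y

/-- The form `∫_Q 2 μ₁ χ₂ e(u) : conj (e(v))`, with `χ₂` the characteristic function of `Q₂`. -/
def formχ (u v : Space C) : ℂ :=
  ∫ y in C.Q₁ ∪ C.Q₂, 2 * (C.μ₁ : ℂ) * C.Q₂.indicator (fun _ => (1 : ℂ)) y * frob u v y

/-- An element of `H(Q)` is determined by its velocity field. -/
theorem ext_velocity {u v : Space C} (h : u.velocity = v.velocity) : u = v := by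
  have hO : IsOpen (C.Q₁ ∪ C.Q₂) := C.isOpen₁.union C.isOpen₂
  have hv : u.1.1 = v.1.1 := h
  refine Subtype.ext (Prod.ext hv ?_)
  funext i j
  have hloc : ∀ f : L2 C, LocallyIntegrableOn f (C.Q₁ ∪ C.Q₂) volume := by
    intro f
    have h1 : MemLp (fun _ : Pt n => (1 : ℂ)) 2 (volume.restrict (C.Q₁ ∪ C.Q₂)) :=
      memLp_of_continuous (C := C) Subset.rfl continuous_const
    have := integrable_mul (C := C) Subset.rfl f h1
    simp only [mul_one] at this
    exact IntegrableOn.locallyIntegrableOn this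
  have key := hO.ae_eq_zero_of_integral_contDiff_smul_eq_zero (μ := volume)
    (f := fun y => u.1.2 i j y - v.1.2 i j y) ((hloc _).sub (hloc _)) (by
      intro g hg hc hs
      let φ : Pt n → ℂ := fun y => (g y : ℂ)
      have hsupp : Function.support φ = Function.support g := by
        ext y
        simp [φ]
      have hts : tsupport φ = tsupport g := by simp only [tsupport, hsupp]
      have hφ : IsTestFunction (C.Q₁ ∪ C.Q₂) φ := by
        refine ⟨Complex.ofRealCLM.contDiff.comp hg, ?_, hts ▸ hs⟩
        simpa [HasCompactSupport, hts] using hc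
      have e := u.2.weak_gradient i j φ hφ
      have e' := v.2.weak_gradient i j φ hφ
      rw [hv, e', neg_inj] at e
      have hm : MemLp φ 2 (volume.restrict (C.Q₁ ∪ C.Q₂)) :=
        memLp_of_continuous (C := C) Subset.rfl hφ.1.continuous
      have e2 : ∫ y in C.Q₁ ∪ C.Q₂, g y • (u.1.2 i j y - v.1.2 i j y) = 0 := by
        have : ∀ y, g y • (u.1.2 i j y - v.1.2 i j y) =
            u.1.2 i j y * φ y - v.1.2 i j y * φ y := by
          intro y
          simp only [Complex.real_smul, φ]
          ring
        simp_rw [this]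
        rw [integral_sub (integrable_mul Subset.rfl _ hm) (integrable_mul Subset.rfl _ hm), e,
          sub_self]
      rw [← e2, setIntegral_eq_integral_of_forall_compl_eq_zero]
      intro y hy
      have : g y = 0 := by
        by_contra hne
        exact hy (hs (subset_tsupport g hne))
      simp [this])
  refine Lp.ext ?_
  filter_upwards [(ae_restrict_iff' hO.measurableSet).2 key] with y hy
  exact sub_eq_zero.1 hy

/-! ### `H(Q)` as an inner product space -/

theorem form_eq (u v : Space C) :
    form u v = 2 * (C.μ₁ : ℂ) * ∑ i, ∑ j, inner ℂ (v.symGrad i j) (u.symGrad i j) := by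
  unfold form frob
  have hint : ∀ i j, Integrable (fun y => u.symGrad i j y * conj (v.symGrad i j y))
      (volume.restrict (C.Q₁ ∪ C.Q₂)) := by
    intro i j
    exact L2.integrable_inner (𝕜 := ℂ) (v.symGrad i j) (u.symGrad i j)
  rw [integral_const_mul, integral_finsetSum _ fun i _ => integrable_finsetSum _ fun j _ => hint i j]
  congr 1
  refine Finset.sum_congr rfl fun i _ => ?_
  rw [integral_finsetSum _ fun j _ => hint i j]
  rfl

theorem symGrad_add (u v : Space C) (i j : Fin n) :
    (u + v).symGrad i j = u.symGrad i j + v.symGrad i j := by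
  have h : ∀ i j, (u + v).grad i j = u.grad i j + v.grad i j := fun _ _ => rfl
  simp only [symGrad, h, ← smul_add]
  congr 1
  abel

theorem symGrad_smul (c : ℂ) (u : Space C) (i j : Fin n) :
    (c • u).symGrad i j = c • u.symGrad i j := by
  have h : ∀ i j, (c • u).grad i j = c • u.grad i j := fun _ _ => rfl
  simp only [symGrad, h, ← smul_add]
  rw [smul_comm]

/-- The positive semidefinite Hermitian form `(·,·)_Q`. The convention of the library is that inner
products are linear in the second argument, so `inner ℂ u v` is `(v, u)_Q`. -/
instance core (C : Cell n) : PreInnerProductSpace.Core ℂ (Space C) where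
  inner u v := form v u
  conj_inner_symm u v := by
    simp only [form_eq, map_mul, map_sum, inner_conj_symm, Complex.conj_ofReal, map_ofNat]
  re_inner_nonneg u := by
    have h : form u u = ((2 * C.μ₁ * ∑ i, ∑ j, ‖u.symGrad i j‖ ^ 2 : ℝ) : ℂ) := by
      simp only [form_eq, inner_self_eq_norm_sq_to_K]
      push_cast
      rfl
    rw [h]
    change 0 ≤ (((2 * C.μ₁ * ∑ i, ∑ j, ‖u.symGrad i j‖ ^ 2 : ℝ) : ℂ)).re
    rw [Complex.ofReal_re]
    have := C.μ₁_pos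
    positivity
  add_left u v w := by
    simp only [form_eq, symGrad_add, inner_add_left, Finset.sum_add_distrib, mul_add]
  smul_left u v c := by
    simp only [form_eq, symGrad_smul, inner_smul_left, ← Finset.mul_sum]
    ring

/-- The norm `‖u‖_Q = √(u, u)_Q`. -/
instance (C : Cell n) : SeminormedAddCommGroup (Space C) :=
  InnerProductSpace.Core.toSeminormedAddCommGroup (𝕜 := ℂ)

instance (C : Cell n) : InnerProductSpace ℂ (Space C) := InnerProductSpace.ofCore (core C)

end Space

end TwoFluid

end

noncomputable section

namespace TwoFluid

variable {n : ℕ}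

/-! ### Fourier series on the unit cell -/

/-! Everything rests on one coercivity estimate: the energy of the symmetric gradient controls both
`v` and `∇v` in `L²`. On the periodic cell it follows from Fourier series. Periodicity, tested
against exponentials, turns `∂ⱼ` into multiplication by `2πi kⱼ` (`IsAdmissible.coeff_grad`). For a
single mode, Korn's inequality is algebra, because the cross terms add up to a square
(`sum_norm_sq_le_symm`). Parseval sums it over all modes, and also gives the Poincaré inequality,
since every nonzero frequency has size at least one. The remaining mode, the mean, is bounded
because orthogonality to translations makes the integral of `v` over the inclusion vanish
(`norm_coeff_zero_sq_mul_le`).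

Coercivity makes the form definite and its norm equivalent to the `L²` norm of the pair `(v, ∇v)`.
The admissible pairs form a closed subspace, so `H(Q)` is complete. The form with `χ₂` is Hermitian,
nonnegative and bounded with constant 1, because restriction to `Q₂` is a contraction of `L²`
(`norm_formχ_le`). Riesz representation then gives the operator, which inherits these properties;
definiteness gives uniqueness. -/

/-- The exponential `exp (-2πi k · y)`. -/
def wave (k : Fin n → ℤ) (y : Pt n) : ℂ :=
  Complex.exp (∑ i, -(2 * Real.pi * Complex.I * k i) * (y i : ℂ))

theorem wave_zero (y : Pt n) : wave 0 y = 1 := by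
  simp [wave]

theorem contDiff_wave (k : Fin n → ℤ) : ContDiff ℝ ∞ (wave k : Pt n → ℂ) := by
  unfold wave
  refine ContDiff.cexp (ContDiff.sum fun i _ => contDiff_const.mul ?_)
  exact Complex.ofRealCLM.contDiff.comp (EuclideanSpace.proj i : Pt n →L[ℝ] ℝ).contDiff

theorem isPeriodicSmooth_wave (k : Fin n → ℤ) : IsPeriodicSmooth (wave k : Pt n → ℂ) := by
  refine ⟨contDiff_wave k, fun i y => ?_⟩
  have h : ∑ j, -(2 * Real.pi * Complex.I * k j) * ((y + EuclideanSpace.single i (1 : ℝ)) j : ℂ) =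
      (∑ j, -(2 * Real.pi * Complex.I * k j) * (y j : ℂ)) +
        (-k i : ℤ) * (2 * Real.pi * Complex.I) := by
    simp only [PiLp.add_apply, Complex.ofReal_add, mul_add, Finset.sum_add_distrib]
    congr 1
    rw [Finset.sum_eq_single i]
    · simp
      ring
    · intro j _ hj
      simp [hj]
    · simp
  rw [wave, h, Complex.exp_add, Complex.exp_int_mul_two_pi_mul_I, mul_one, wave]

theorem partialDeriv_wave (k : Fin n → ℤ) (j : Fin n) (y : Pt n) :
    partialDeriv j (wave k) y = -(2 * Real.pi * Complex.I * k j) * wave k y := by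
  have h : HasFDerivAt (fun y : Pt n => ∑ i, -(2 * Real.pi * Complex.I * k i) * (y i : ℂ))
      (∑ i, (-(2 * Real.pi * Complex.I * k i)) •
        (Complex.ofRealCLM.comp (EuclideanSpace.proj i : Pt n →L[ℝ] ℝ))) y := by
    refine HasFDerivAt.fun_sum fun i _ => ?_
    exact (Complex.ofRealCLM.comp
      (EuclideanSpace.proj i : Pt n →L[ℝ] ℝ)).hasFDerivAt.const_mul _
  have hw : HasFDerivAt (wave k : Pt n → ℂ) _ y := h.cexp
  rw [partialDeriv, hw.fderiv, smul_apply, smul_eq_mul, mul_comm]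
  congr 1
  rw [sum_apply, Finset.sum_eq_single j]
  · simp
  · intro i _ hi
    simp [hi]
  · simp

/-! ### Transport of Parseval's identity from the torus to the cell -/

theorem measurableSet_unitCell : MeasurableSet (unitCell n) := by
  have h : unitCell n = ⋂ i, (fun y : Pt n => y i) ⁻¹' Ioo 0 1 := by
    ext y
    simp [unitCell]
  rw [h]
  refine MeasurableSet.iInter fun i => measurableSet_Ioo.preimage ?_
  exact (EuclideanSpace.proj i : Pt n →L[ℝ] ℝ).continuous.measurable

/-- The section of the covering map `ℝⁿ → (ℝ/ℤ)ⁿ` with values in the half-open cell `(0,1]ⁿ`. -/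
def torusSection (n : ℕ) (x : UnitAddTorus (Fin n)) : Pt n :=
  WithLp.toLp 2 fun i => (AddCircle.equivIoc 1 0 (x i) : ℝ)

theorem coe_torusSection (x : UnitAddTorus (Fin n)) (i : Fin n) :
    ((torusSection n x i : ℝ) : UnitAddCircle) = x i :=
  (AddCircle.equivIoc (1 : ℝ) 0).symm_apply_apply (x i)

/-- The Fourier coefficient of index `k` on the torus is an integral against the character of index
`-k`; this is the source of the minus sign in `wave`. -/
theorem mFourier_neg_eq_wave (k : Fin n → ℤ) (x : UnitAddTorus (Fin n)) :
    UnitAddTorus.mFourier (-k) x = wave k (torusSection n x) := by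
  rw [wave, Complex.exp_sum]
  change ∏ i, fourier ((-k) i) (x i) = _
  refine Finset.prod_congr rfl fun i _ => ?_
  rw [← coe_torusSection x i, fourier_coe_apply]
  congr 1
  simp

/-- The product of the normalised Haar measures on `(ℝ/ℤ)ⁿ`. -/
def torusMeasure (n : ℕ) : Measure (UnitAddTorus (Fin n)) :=
  Measure.pi fun _ => (AddCircle.haarAddCircle : Measure UnitAddCircle)

/-- The torus is parametrised by a half-open cube and `Q` is open; they differ by faces, which are
null. -/
theorem restrict_cube_ae_eq :
    (volume.restrict {x : Fin n → ℝ | ∀ i, x i ∈ Ioc (0 : ℝ) (0 + 1)}) =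
      volume.restrict {x : Fin n → ℝ | ∀ i, x i ∈ Ioo (0 : ℝ) 1} := by
  have h : (univ.pi fun _ : Fin n => Ioo (0 : ℝ) 1) =ᵐ[volume] univ.pi fun _ => Ioc (0 : ℝ) 1 :=
    Measure.univ_pi_Ioo_ae_eq_Icc.trans Measure.univ_pi_Ioc_ae_eq_Icc.symm
  simp only [zero_add]
  refine Measure.restrict_congr_set ?_
  have h1 : {x : Fin n → ℝ | ∀ i, x i ∈ Ioo (0 : ℝ) 1} = univ.pi fun _ => Ioo (0 : ℝ) 1 := by
    ext; simp
  have h2 : {x : Fin n → ℝ | ∀ i, x i ∈ Ioc (0 : ℝ) 1} = univ.pi fun _ => Ioc (0 : ℝ) 1 := by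
    ext; simp
  rw [h1, h2]
  exact h.symm

theorem torusSection_eq :
    torusSection n = MeasurableEquiv.toLp 2 (Fin n → ℝ) ∘ Subtype.val ∘
      UnitAddTorus.measurableEquivPiIoc (fun _ : Fin n => (0 : ℝ)) := rfl

theorem measurableSet_cube :
    MeasurableSet {x : Fin n → ℝ | ∀ i, x i ∈ Ioc (0 : ℝ) (0 + 1)} :=
  MeasurableSet.univ_pi' fun _ => measurableSet_Ioc

theorem measurableEmbedding_torusSection : MeasurableEmbedding (torusSection n) := by
  rw [torusSection_eq]
  exact (MeasurableEquiv.measurableEmbedding _).comp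
    ((MeasurableEmbedding.subtype_coe measurableSet_cube).comp
      (MeasurableEquiv.measurableEmbedding _))

theorem measurePreserving_torusSection :
    MeasurePreserving (torusSection n) (torusMeasure n) (volume.restrict (unitCell n)) := by
  have h1 : MeasurePreserving (UnitAddTorus.measurableEquivPiIoc (fun _ : Fin n => (0 : ℝ)))
      (torusMeasure n) (Measure.comap Subtype.val volume) :=
    UnitAddTorus.measurePreserving_equivPiIoc fun _ => 0
  have h2 : MeasurePreserving
      (Subtype.val : {x : Fin n → ℝ // ∀ i, x i ∈ Ioc (0 : ℝ) (0 + 1)} → Fin n → ℝ)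
      (Measure.comap Subtype.val volume)
      (volume.restrict {x : Fin n → ℝ | ∀ i, x i ∈ Ioo (0 : ℝ) 1}) :=
    ⟨measurable_subtype_coe, by
      rw [← restrict_cube_ae_eq]
      exact map_comap_subtype_coe measurableSet_cube volume⟩
  have h3 : MeasurePreserving (MeasurableEquiv.toLp 2 (Fin n → ℝ))
      (volume.restrict {x : Fin n → ℝ | ∀ i, x i ∈ Ioo (0 : ℝ) 1})
      (volume.restrict (unitCell n)) :=
    (PiLp.volume_preserving_toLp (Fin n)).restrict_preimage measurableSet_unitCell
  rw [torusSection_eq]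
  exact h3.comp (h2.comp h1)

/-- Parseval's identity on the unit cell. -/
theorem hasSum_sq_norm_integral_mul_wave {f : Pt n → ℂ}
    (hf : MemLp f 2 (volume.restrict (unitCell n))) :
    HasSum (fun k : Fin n → ℤ => ‖∫ y in unitCell n, f y * wave k y‖ ^ 2)
      (∫ y in unitCell n, ‖f y‖ ^ 2) := by
  have hF := hf.comp_measurePreserving measurePreserving_torusSection
  have h : HasSum (fun k : Fin n → ℤ => ‖∫ x, UnitAddTorus.mFourier (-k) x • hF.toLp _ x
      ∂torusMeasure n‖ ^ 2) (∫ x, ‖hF.toLp _ x‖ ^ 2 ∂torusMeasure n) :=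
    UnitAddTorus.hasSum_sq_mFourierCoeff (hF.toLp _)
  convert h using 1
  · funext k
    congr 2
    rw [← measurePreserving_torusSection.integral_comp measurableEmbedding_torusSection]
    refine integral_congr_ae ?_
    filter_upwards [hF.coeFn_toLp] with x hx
    rw [hx, mFourier_neg_eq_wave, smul_eq_mul, mul_comm, Function.comp_apply]
  · rw [← measurePreserving_torusSection.integral_comp measurableEmbedding_torusSection]
    refine integral_congr_ae ?_
    filter_upwards [hF.coeFn_toLp] with x hx
    rw [hx, Function.comp_apply]

theorem volume_unitCell : volume (unitCell n) = 1 := by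
  have h := measurePreserving_torusSection (n := n).measure_preimage MeasurableSet.univ.nullMeasurableSet
  rw [Measure.restrict_apply_univ, preimage_univ, torusMeasure] at h
  rw [← h, Measure.pi_univ]
  simp

/-! ### Fourier coefficients of functions on the two regions -/

section FourierCoefficients

variable {C : Cell n}

theorem Cell.subset_unitCell (C : Cell n) : C.Q₁ ∪ C.Q₂ ⊆ unitCell n :=
  union_subset C.subset₁ C.subset₂

theorem Cell.measurableSet_regions (C : Cell n) : MeasurableSet (C.Q₁ ∪ C.Q₂) :=
  (C.isOpen₁.union C.isOpen₂).measurableSet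

theorem Cell.measureReal_pos₂ (C : Cell n) : 0 < volume.real C.Q₂ :=
  ENNReal.toReal_pos C.volume_pos₂.ne'
    ((measure_mono C.subset₂).trans_lt (by rw [volume_unitCell]; exact ENNReal.one_lt_top)).ne

/-- The Fourier coefficient at `k` of the extension of `f` by zero to the cell. -/
def coeff (f : L2 C) (k : Fin n → ℤ) : ℂ := ∫ y in C.Q₁ ∪ C.Q₂, f y * wave k y

theorem memLp_wave (k : Fin n → ℤ) : MemLp (wave k) 2 (volume.restrict (C.Q₁ ∪ C.Q₂)) :=
  memLp_of_continuous Subset.rfl (contDiff_wave k).continuous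

theorem coeff_add (f g : L2 C) (k : Fin n → ℤ) : coeff (f + g) k = coeff f k + coeff g k :=
  integral_add_mul Subset.rfl f g (memLp_wave k)

theorem coeff_smul (c : ℂ) (f : L2 C) (k : Fin n → ℤ) : coeff (c • f) k = c * coeff f k :=
  integral_smul_mul Subset.rfl c f _

theorem memLp_indicator (f : L2 C) :
    MemLp ((C.Q₁ ∪ C.Q₂).indicator f) 2 (volume.restrict (unitCell n)) := by
  rw [memLp_indicator_iff_restrict C.measurableSet_regions,
    Measure.restrict_restrict_of_subset C.subset_unitCell]
  exact Lp.memLp f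

theorem setIntegral_indicator_regions {E : Type*} [NormedAddCommGroup E] [NormedSpace ℝ E]
    (g : Pt n → E) :
    ∫ y in unitCell n, (C.Q₁ ∪ C.Q₂).indicator g y = ∫ y in C.Q₁ ∪ C.Q₂, g y := by
  rw [setIntegral_indicator C.measurableSet_regions, inter_eq_right.2 C.subset_unitCell]

theorem norm_sq_eq_integral {α : Type*} [MeasurableSpace α] {μ : Measure α} (f : Lp ℂ 2 μ) :
    ‖f‖ ^ 2 = ∫ y, ‖f y‖ ^ 2 ∂μ := by
  rw [← inner_self_eq_norm_sq (𝕜 := ℂ), L2.inner_def, ← integral_re (L2.integrable_inner f f)]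
  simp only [inner_self_eq_norm_sq]

theorem integral_norm_sq_indicator (f : L2 C) :
    ∫ y in unitCell n, ‖(C.Q₁ ∪ C.Q₂).indicator f y‖ ^ 2 = ‖f‖ ^ 2 := by
  rw [norm_sq_eq_integral, ← setIntegral_indicator_regions]
  congr 1
  funext y
  by_cases hy : y ∈ C.Q₁ ∪ C.Q₂ <;> simp only [indicator_of_mem, indicator_of_notMem, hy,
    not_false_eq_true, norm_zero, ne_eq, OfNat.ofNat_ne_zero, zero_pow]

/-- Parseval's identity. -/
theorem hasSum_sq_coeff (f : L2 C) : HasSum (fun k => ‖coeff f k‖ ^ 2) (‖f‖ ^ 2) := by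
  convert hasSum_sq_norm_integral_mul_wave (memLp_indicator f) using 1
  · funext k
    rw [coeff, ← setIntegral_indicator_regions]
    simp only [indicator_mul_left]
  · exact (integral_norm_sq_indicator f).symm

/-- In a Hilbert space, let `e` be a unit vector, `f` orthogonal to `h`, and
`⟪h, e⟫ = ‖h‖² > 0`. Then the component of `f` along `e` is controlled by the rest of `f`. -/
theorem norm_inner_sq_mul_le {E : Type*} [NormedAddCommGroup E] [InnerProductSpace ℂ E]
    {e h f : E} {s : ℝ} (hs : 0 < s) (he : ‖e‖ = 1) (hf : inner ℂ h f = 0)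
    (hhe : inner ℂ h e = s) (hh : ‖h‖ ^ 2 = s) :
    ‖inner ℂ e f‖ ^ 2 * s ≤ ‖f‖ ^ 2 - ‖inner ℂ e f‖ ^ 2 := by
  set m := inner ℂ e f
  -- Since `h ⟂ f`, pairing `h` with the fluctuation `f - m • e` sees only the mean part `-m • e`.
  -- Cauchy–Schwarz then bounds `m` by the fluctuation.
  have h1 : inner ℂ h (f - m • e) = -(m * s) := by
    rw [inner_sub_right, inner_smul_right, hf, hhe, zero_sub]
  have horth : inner ℂ (f - m • e) (m • e) = 0 := by
    rw [← inner_conj_symm, inner_smul_left, inner_sub_right, inner_smul_right,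
      inner_self_eq_norm_sq_to_K, he]
    simp [m]
  have h2 : ‖f‖ ^ 2 = ‖f - m • e‖ ^ 2 + ‖m‖ ^ 2 := by
    have := norm_add_sq_eq_norm_sq_add_norm_sq_of_inner_eq_zero _ _ horth
    rw [sub_add_cancel, norm_smul, he, mul_one] at this
    nlinarith
  have h3 : ‖m‖ * s ≤ ‖h‖ * ‖f - m • e‖ := by
    have := norm_inner_le_norm (𝕜 := ℂ) h (f - m • e)
    rwa [h1, norm_neg, norm_mul, Complex.norm_real, Real.norm_of_nonneg hs.le] at this
  have h4 : (‖m‖ * s) ^ 2 ≤ (‖h‖ * ‖f - m • e‖) ^ 2 := by gcongr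
  rw [mul_pow, mul_pow, hh] at h4
  rw [h2, add_sub_cancel_right]
  refine le_of_mul_le_mul_left ?_ hs
  linarith

/-- The mean of a function whose integral over the inclusion vanishes is controlled by its
variance. -/
theorem norm_coeff_zero_sq_mul_le {f : L2 C} (hf : ∫ y in C.Q₂, f y = 0) :
    ‖coeff f 0‖ ^ 2 * volume.real C.Q₂ ≤ ‖f‖ ^ 2 - ‖coeff f 0‖ ^ 2 := by
  set μ := volume.restrict (unitCell n)
  have hμ : IsProbabilityMeasure μ :=
    ⟨by rw [Measure.restrict_apply_univ, volume_unitCell]⟩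
  have hF := memLp_indicator f
  have hm := C.isOpen₂.measurableSet
  have hr : μ.real C.Q₂ = volume.real C.Q₂ := by
    rw [measureReal_restrict_apply hm, inter_eq_left.2 C.subset₂]
  -- Here `e` is the constant 1 and `h` the characteristic function of `Q₂`, so that `⟪h, e⟫ = ‖h‖²
  -- = |Q₂|`.
  let e : Lp ℂ 2 μ := indicatorConstLp 2 MeasurableSet.univ (measure_ne_top _ _) (1 : ℂ)
  let h : Lp ℂ 2 μ := indicatorConstLp 2 hm (measure_ne_top _ _) (1 : ℂ)
  have hn : ‖hF.toLp _‖ ^ 2 = ‖f‖ ^ 2 := by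
    rw [norm_sq_eq_integral, ← integral_norm_sq_indicator]
    refine integral_congr_ae ?_
    filter_upwards [hF.coeFn_toLp] with y hy
    rw [hy]
  have he : ‖e‖ = 1 := by
    rw [norm_indicatorConstLp (by simp) (by simp)]
    simp
  have h1 : inner ℂ e (hF.toLp _) = coeff f 0 := by
    rw [L2.inner_indicatorConstLp_one, setIntegral_univ, integral_congr_ae hF.coeFn_toLp,
      setIntegral_indicator_regions, coeff]
    simp only [wave_zero, mul_one]
  have h2 : inner ℂ h (hF.toLp _) = 0 := by
    rw [L2.inner_indicatorConstLp_one, integral_congr_ae (ae_restrict_of_ae hF.coeFn_toLp),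
      Measure.restrict_restrict_of_subset C.subset₂, ← hf]
    refine setIntegral_congr_fun hm fun y hy => ?_
    exact indicator_of_mem (mem_union_right _ hy) _
  have h3 : inner ℂ h e = (volume.real C.Q₂ : ℂ) := by
    rw [L2.inner_indicatorConstLp_one, integral_congr_ae
      (ae_restrict_of_ae indicatorConstLp_coeFn)]
    simp [hr]
  have h4 : ‖h‖ ^ 2 = volume.real C.Q₂ := by
    rw [← inner_self_eq_norm_sq (𝕜 := ℂ), L2.inner_indicatorConstLp_one, integral_congr_ae
      (ae_restrict_of_ae indicatorConstLp_coeFn),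
      setIntegral_congr_fun hm (g := fun _ => (1 : ℂ)) fun y hy => indicator_of_mem hy _]
    simp [hr]
  rw [← h1, ← hn]
  exact norm_inner_sq_mul_le C.measureReal_pos₂ he h2 h3 h4

end FourierCoefficients

/-! ### Coercivity -/

section Coercivity

variable {C : Cell n}

/-- Green's formula against the periodic function `wave k` has no boundary or interface term, so the
weak derivative can be moved onto the exponential. -/
theorem IsAdmissible.coeff_grad {v : Fin n → L2 C} {G : Fin n → Fin n → L2 C}
    (h : IsAdmissible C v G) (i j : Fin n) (k : Fin n → ℤ) :
    coeff (G i j) k = 2 * Real.pi * Complex.I * k j * coeff (v i) k := by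
  have hp := h.periodic i j (wave k) (isPeriodicSmooth_wave k)
  simp only [boundaryPairing, partialDeriv_wave] at hp
  have hc : ∫ y in C.Q₁ ∪ C.Q₂, v i y * (-(2 * Real.pi * Complex.I * k j) * wave k y) =
      -(2 * Real.pi * Complex.I * k j) * coeff (v i) k := by
    rw [coeff, ← integral_const_mul]
    congr 1
    funext y
    ring
  rw [hc] at hp
  rw [coeff]
  linear_combination hp

/-- Korn's inequality for a single Fourier mode. -/
theorem sum_norm_sq_le_symm (c : ℂ) (k : Fin n → ℝ) (a : Fin n → ℂ) :
    ∑ i, ∑ j, ‖c * k j * a i‖ ^ 2 ≤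
      2 * ∑ i, ∑ j, ‖(1 / 2 : ℂ) * (c * k j * a i + c * k i * a j)‖ ^ 2 := by
  have h1 : ∀ x y : ℂ, 2 * ‖(1 / 2 : ℂ) * (x + y)‖ ^ 2 =
      (‖x‖ ^ 2 + ‖y‖ ^ 2) / 2 + (x * conj y).re := by
    intro x y
    rw [norm_mul, mul_pow, Complex.sq_norm (x + y), Complex.normSq_add, Complex.sq_norm x,
      Complex.sq_norm y]
    norm_num
    ring
  -- The cross terms form the squared modulus of the `k`-th coefficient of the divergence, so they
  -- are nonnegative and can be dropped.
  have h2 : ∑ i, ∑ j, (c * k j * a i) * conj (c * k i * a j) =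
      (‖∑ i, c * k i * a i‖ ^ 2 : ℝ) := by
    rw [Complex.sq_norm, Complex.normSq_eq_conj_mul_self, mul_comm, map_sum, Finset.sum_mul_sum]
    refine Finset.sum_congr rfl fun i _ => Finset.sum_congr rfl fun j _ => ?_
    simp only [map_mul, Complex.conj_ofReal]
    ring
  have h3 : 0 ≤ ∑ i, ∑ j, ((c * k j * a i) * conj (c * k i * a j)).re := by
    simp only [← Complex.re_sum]
    rw [h2, Complex.ofReal_re]
    positivity
  have h4 : ∑ i, ∑ j, ‖c * k i * a j‖ ^ 2 = ∑ i, ∑ j, ‖c * k j * a i‖ ^ 2 :=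
    Finset.sum_comm
  simp only [Finset.mul_sum, h1, Finset.sum_add_distrib, ← Finset.sum_div, h4]
  linarith

/-- Korn's inequality on the periodic cell. -/
theorem IsAdmissible.sum_norm_grad_sq_le {v : Fin n → L2 C} {G : Fin n → Fin n → L2 C}
    (h : IsAdmissible C v G) :
    ∑ i, ∑ j, ‖G i j‖ ^ 2 ≤ 2 * ∑ i, ∑ j, ‖(1 / 2 : ℂ) • (G i j + G j i)‖ ^ 2 := by
  -- By Parseval both sides are sums over `k`, to be compared mode by mode.
  refine hasSum_le (fun k => ?_)
    (hasSum_sum fun i _ => hasSum_sum fun j _ => hasSum_sq_coeff (G i j))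
    ((hasSum_sum fun i _ => hasSum_sum fun j _ =>
      hasSum_sq_coeff ((1 / 2 : ℂ) • (G i j + G j i))).mul_left 2)
  simp only [coeff_smul, coeff_add, h.coeff_grad]
  exact_mod_cast sum_norm_sq_le_symm (2 * Real.pi * Complex.I) (fun j => (k j : ℝ))
    fun i => coeff (v i) k

/-- Some `kⱼ` is a nonzero integer, so `|2π kⱼ| ≥ 1` and that single derivative already dominates.
-/
theorem IsAdmissible.norm_coeff_sq_le {v : Fin n → L2 C} {G : Fin n → Fin n → L2 C}
    (h : IsAdmissible C v G) (i : Fin n) {k : Fin n → ℤ} (hk : k ≠ 0) :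
    ‖coeff (v i) k‖ ^ 2 ≤ ∑ j, ‖coeff (G i j) k‖ ^ 2 := by
  obtain ⟨j, hj⟩ := Function.ne_iff.1 hk
  refine le_trans ?_ (Finset.single_le_sum (f := fun j => ‖coeff (G i j) k‖ ^ 2)
    (fun _ _ => sq_nonneg _) (Finset.mem_univ j))
  have hk1 : (1 : ℝ) ≤ |(k j : ℝ)| := by exact_mod_cast Int.one_le_abs hj
  have h1 : (1 : ℝ) ≤ ‖(2 * Real.pi * Complex.I * k j : ℂ)‖ := by
    simp only [norm_mul, Complex.norm_I, Complex.norm_intCast, Complex.norm_real, mul_one,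
      Complex.norm_ofNat, Real.norm_of_nonneg Real.pi_pos.le]
    nlinarith [Real.pi_gt_three]
  simp only [h.coeff_grad, norm_mul _ (coeff (v i) k), mul_pow]
  exact le_mul_of_one_le_left (sq_nonneg _) (one_le_pow₀ h1)

/-- The Poincaré inequality, with an explicit mean. -/
theorem IsAdmissible.norm_sq_sub_le {v : Fin n → L2 C} {G : Fin n → Fin n → L2 C}
    (h : IsAdmissible C v G) (i : Fin n) :
    ‖v i‖ ^ 2 - ‖coeff (v i) 0‖ ^ 2 ≤ ∑ j, ‖G i j‖ ^ 2 := by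
  rw [sub_le_iff_le_add]
  -- The squared mean is written as a series supported at `k = 0`, the one mode that the gradient
  -- does not see.
  refine hasSum_le (fun k => ?_) (hasSum_sq_coeff (v i))
    ((hasSum_sum fun j _ => hasSum_sq_coeff (G i j)).add
      (hasSum_ite_eq (0 : Fin n → ℤ) (‖coeff (v i) 0‖ ^ 2)))
  by_cases hk : k = 0
  · simp only [hk, if_true]
    exact le_add_of_nonneg_left (Finset.sum_nonneg fun _ _ => sq_nonneg _)
  · simp only [hk, if_false, add_zero]
    exact h.norm_coeff_sq_le i hk

/-- A translation is a rigid displacement with zero gradient, so only the `L²` part of the `H¹(Q₂)`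
product survives. -/
theorem IsAdmissible.setIntegral_inclusion {v : Fin n → L2 C} {G : Fin n → Fin n → L2 C}
    (h : IsAdmissible C v G) (i : Fin n) : ∫ y in C.Q₂, v i y = 0 := by
  have ho := h.orthogonal_rigid 0 (Pi.single i 1) (by simp)
  rw [Finset.sum_eq_single i] at ho
  · simpa using ho
  · intro j _ hj
    simp [hj]
  · simp

/-- The velocity is controlled by its gradient. -/
theorem IsAdmissible.norm_velocity_sq_le {v : Fin n → L2 C} {G : Fin n → Fin n → L2 C}
    (h : IsAdmissible C v G) (i : Fin n) :
    ‖v i‖ ^ 2 ≤ (1 + (volume.real C.Q₂)⁻¹) * ∑ j, ‖G i j‖ ^ 2 := by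
  have h1 := h.norm_sq_sub_le i
  have h2 := (norm_coeff_zero_sq_mul_le (h.setIntegral_inclusion i)).trans h1
  rw [← le_div_iff₀ C.measureReal_pos₂] at h2
  rw [add_mul, one_mul, inv_mul_eq_div]
  linarith

end Coercivity

/-! ### Completeness -/

section Completeness

variable {C : Cell n}

/-- The integral is the `L²` inner product with the extension by zero of the conjugate of `g`. -/
theorem continuous_setIntegral_mul {U : Set (Pt n)} (hU : U ⊆ C.Q₁ ∪ C.Q₂) (hm : MeasurableSet U)
    {g : Pt n → ℂ} (hg : MemLp g 2 (volume.restrict U)) :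
    Continuous fun f : L2 C => ∫ y in U, f y * g y := by
  have hs : MemLp (U.indicator (star g)) 2 (volume.restrict (C.Q₁ ∪ C.Q₂)) := by
    rw [memLp_indicator_iff_restrict hm, Measure.restrict_restrict_of_subset hU]
    exact hg.star
  have h : (fun f : L2 C => ∫ y in U, f y * g y) = fun f => inner ℂ (hs.toLp _) f := by
    funext f
    have h1 : ∫ y in U, f y * g y = ∫ y in C.Q₁ ∪ C.Q₂, U.indicator (fun y => f y * g y) y := by
      rw [setIntegral_indicator hm, inter_eq_right.2 hU]
    rw [h1, L2.inner_def]
    refine integral_congr_ae ?_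
    filter_upwards [hs.coeFn_toLp] with y hy
    rw [hy]
    by_cases hyU : y ∈ U <;> simp [hyU]
  rw [h]
  exact continuous_const.inner continuous_id

theorem continuous_boundaryPairing {X : Type*} [TopologicalSpace X] {U : Set (Pt n)}
    (hU : U ⊆ C.Q₁ ∪ C.Q₂) (hm : MeasurableSet U) {φ ψ : Pt n → ℂ}
    (hφ : MemLp φ 2 (volume.restrict U)) (hψ : MemLp ψ 2 (volume.restrict U))
    {f g : X → L2 C} (hf : Continuous f) (hg : Continuous g) :
    Continuous fun x => boundaryPairing U (f x) (g x) φ ψ :=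
  ((continuous_setIntegral_mul hU hm hψ).comp hf).add ((continuous_setIntegral_mul hU hm hφ).comp hg)

/-- Each defining condition says that an `L²`-continuous linear expression in `(v, G)` vanishes, for
test data that do not depend on `(v, G)`. -/
theorem isClosed_admissible :
    IsClosed (admissible C : Set ((Fin n → L2 C) × (Fin n → Fin n → L2 C))) := by
  have h1 : C.Q₁ ⊆ C.Q₁ ∪ C.Q₂ := subset_union_left
  have h2 : C.Q₂ ⊆ C.Q₁ ∪ C.Q₂ := subset_union_right
  have m1 := C.isOpen₁.measurableSet
  have m2 := C.isOpen₂.measurableSet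
  have m := C.measurableSet_regions
  have cv : ∀ i, Continuous fun p : (Fin n → L2 C) × (Fin n → Fin n → L2 C) => p.1 i :=
    fun i => (continuous_apply i).comp continuous_fst
  have cG : ∀ i j, Continuous fun p : (Fin n → L2 C) × (Fin n → Fin n → L2 C) => p.2 i j :=
    fun i j => (continuous_apply j).comp ((continuous_apply i).comp continuous_snd)
  refine isClosed_of_closure_subset fun p hp => ?_
  have key : ∀ F : (Fin n → L2 C) × (Fin n → Fin n → L2 C) → ℂ, Continuous F →
      (∀ q ∈ admissible C, F q = 0) → F p = 0 := fun F hF h =>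
    closure_minimal h (isClosed_singleton.preimage hF) hp
  constructor
  · intro i j φ hφ
    rw [← sub_eq_zero]
    refine key (fun q => (∫ y in C.Q₁ ∪ C.Q₂, q.1 i y * partialDeriv j φ y) -
      -∫ y in C.Q₁ ∪ C.Q₂, q.2 i j y * φ y) ?_
      fun q hq => sub_eq_zero.2 (hq.weak_gradient i j φ hφ)
    exact ((continuous_setIntegral_mul Subset.rfl m (memLp_of_continuous (C := C) Subset.rfl
      (continuous_partialDeriv hφ.1 j))).comp (cv i)).sub
        ((continuous_setIntegral_mul Subset.rfl m
          (memLp_of_continuous (C := C) Subset.rfl hφ.1.continuous)).comp (cG i j)).neg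
  · exact closure_minimal (fun q hq => hq.div_free)
      (isClosed_singleton.preimage (continuous_finsetSum _ fun i _ => cG i i)) hp
  · intro φ ψ hφ
    exact key (fun q => ∑ i, boundaryPairing C.Q₂ (q.1 i) (q.2 i i) φ (ψ i))
      (continuous_finsetSum _ fun i _ =>
        continuous_boundaryPairing h2 m2 hφ.1 (hφ.2 i).1 (cv i) (cG i i))
      fun q hq => hq.normal_trace φ ψ hφ
  · intro i j φ hφ
    have hc := hφ.1.continuous
    have hd := continuous_partialDeriv hφ.1 j
    exact key (fun q => boundaryPairing C.Q₁ (q.1 i) (q.2 i j) φ (partialDeriv j φ) +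
        boundaryPairing C.Q₂ (q.1 i) (q.2 i j) φ (partialDeriv j φ))
      ((continuous_boundaryPairing h1 m1 (memLp_of_continuous h1 hc) (memLp_of_continuous h1 hd)
        (cv i) (cG i j)).add
        (continuous_boundaryPairing h2 m2 (memLp_of_continuous h2 hc) (memLp_of_continuous h2 hd)
          (cv i) (cG i j)))
      fun q hq => hq.jump i j φ hφ
  · intro A b hA
    refine key (fun q => (∑ i, ∫ y in C.Q₂, q.1 i y * conj ((∑ j, A i j * (y j : ℂ)) + b i)) +
      (∑ i, ∑ j, ∫ y in C.Q₂, q.2 i j y * conj (A i j))) ?_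
      fun q hq => hq.orthogonal_rigid A b hA
    refine (continuous_finsetSum _ fun i _ => ?_).add
      (continuous_finsetSum _ fun i _ => continuous_finsetSum _ fun j _ => ?_)
    · exact (continuous_setIntegral_mul h2 m2
        (memLp_of_continuous h2 (by fun_prop))).comp (cv i)
    · exact (continuous_setIntegral_mul h2 m2
        (memLp_of_continuous h2 continuous_const)).comp (cG i j)
  · intro i j φ hφ
    exact key (fun q => boundaryPairing (C.Q₁ ∪ C.Q₂) (q.1 i) (q.2 i j) φ (partialDeriv j φ))
      (continuous_boundaryPairing Subset.rfl m
        (memLp_of_continuous (C := C) Subset.rfl hφ.1.continuous)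
        (memLp_of_continuous (C := C) Subset.rfl (continuous_partialDeriv hφ.1 j))
        (cv i) (cG i j))
      fun q hq => hq.periodic i j φ hφ

/-! ### Equivalence of the energy norm with the norm of the pair `(v, ∇v)` -/

namespace Space

theorem norm_sq_eq (u : Space C) :
    ‖u‖ ^ 2 = 2 * C.μ₁ * ∑ i, ∑ j, ‖u.symGrad i j‖ ^ 2 := by
  have h : form u u = ((2 * C.μ₁ * ∑ i, ∑ j, ‖u.symGrad i j‖ ^ 2 : ℝ) : ℂ) := by
    simp only [form_eq, inner_self_eq_norm_sq_to_K]
    push_cast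
    rfl
  rw [← inner_self_eq_norm_sq (𝕜 := ℂ)]
  change (form u u).re = _
  rw [h, Complex.ofReal_re]

/-- The constant 2 of Korn's inequality is absorbed by the factor 2 in `2 μ₁`. -/
theorem sum_norm_grad_sq_le (u : Space C) :
    ∑ i, ∑ j, ‖u.grad i j‖ ^ 2 ≤ C.μ₁⁻¹ * ‖u‖ ^ 2 := by
  have h : ∑ i, ∑ j, ‖u.grad i j‖ ^ 2 ≤ 2 * ∑ i, ∑ j, ‖u.symGrad i j‖ ^ 2 :=
    IsAdmissible.sum_norm_grad_sq_le u.2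
  have := C.μ₁_pos.ne'
  rw [norm_sq_eq]
  refine h.trans_eq ?_
  field_simp

theorem norm_grad_le (u : Space C) (i j : Fin n) : ‖u.grad i j‖ ≤ √(C.μ₁⁻¹) * ‖u‖ := by
  rw [← Real.sqrt_sq (norm_nonneg u), ← Real.sqrt_mul (inv_nonneg.2 C.μ₁_pos.le)]
  refine Real.le_sqrt_of_sq_le (le_trans ?_ u.sum_norm_grad_sq_le)
  refine le_trans ?_ (Finset.single_le_sum (f := fun i => ∑ j, ‖u.grad i j‖ ^ 2)
    (fun _ _ => Finset.sum_nonneg fun _ _ => sq_nonneg _) (Finset.mem_univ i))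
  exact Finset.single_le_sum (f := fun j => ‖u.grad i j‖ ^ 2)
    (fun _ _ => sq_nonneg _) (Finset.mem_univ j)

theorem norm_velocity_le (u : Space C) (i : Fin n) :
    ‖u.velocity i‖ ≤ √((1 + (volume.real C.Q₂)⁻¹) * C.μ₁⁻¹) * ‖u‖ := by
  have h0 : 0 ≤ 1 + (volume.real C.Q₂)⁻¹ := by positivity
  rw [← Real.sqrt_sq (norm_nonneg u), ← Real.sqrt_mul (mul_nonneg h0 (inv_nonneg.2 C.μ₁_pos.le)),
    mul_assoc]
  refine Real.le_sqrt_of_sq_le ((IsAdmissible.norm_velocity_sq_le u.2 i).trans ?_)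
  refine mul_le_mul_of_nonneg_left (le_trans ?_ u.sum_norm_grad_sq_le) h0
  exact Finset.single_le_sum (f := fun i => ∑ j, ‖u.grad i j‖ ^ 2)
    (fun _ _ => Finset.sum_nonneg fun _ _ => sq_nonneg _) (Finset.mem_univ i)

/-- Coercivity in the form used for completeness and definiteness. The constant is a maximum because
products carry the sup norm. -/
theorem exists_norm_pair_le (C : Cell n) :
    ∃ K, ∀ u : Space C, ‖(u.1 : (Fin n → L2 C) × (Fin n → Fin n → L2 C))‖ ≤ K * ‖u‖ := by
  refine ⟨max (√((1 + (volume.real C.Q₂)⁻¹) * C.μ₁⁻¹)) (√(C.μ₁⁻¹)), fun u => ?_⟩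
  rw [max_mul_of_nonneg _ _ (norm_nonneg u), Prod.norm_def]
  refine max_le_max ?_ ?_
  · exact (pi_norm_le_iff_of_nonneg (by positivity)).2 u.norm_velocity_le
  · exact (pi_norm_le_iff_of_nonneg (by positivity)).2 fun i =>
      (pi_norm_le_iff_of_nonneg (by positivity)).2 fun j => u.norm_grad_le i j

theorem norm_symGrad_le (u : Space C) (i j : Fin n) :
    ‖u.symGrad i j‖ ≤ ‖(u.1 : (Fin n → L2 C) × (Fin n → Fin n → L2 C))‖ := by
  have h : ∀ i j, ‖u.grad i j‖ ≤ ‖(u.1 : (Fin n → L2 C) × (Fin n → Fin n → L2 C))‖ := fun i j =>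
    (norm_le_pi_norm (u.1.2 i) j).trans ((norm_le_pi_norm u.1.2 i).trans (norm_snd_le u.1))
  rw [symGrad, norm_smul]
  have h1 := norm_add_le (u.grad i j) (u.grad j i)
  have h2 := h i j
  have h3 := h j i
  norm_num
  linarith

theorem exists_norm_le (C : Cell n) :
    ∃ K, ∀ u : Space C, ‖u‖ ≤ K * ‖(u.1 : (Fin n → L2 C) × (Fin n → Fin n → L2 C))‖ := by
  -- The factor `n * n` counts the entries of the symmetric gradient, each bounded by the sup norm
  -- of the pair.
  refine ⟨√(2 * C.μ₁ * (n * n)), fun u => ?_⟩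
  have h0 : 0 ≤ 2 * C.μ₁ := by linarith [C.μ₁_pos]
  rw [← Real.sqrt_sq (norm_nonneg (u.1 : (Fin n → L2 C) × (Fin n → Fin n → L2 C))),
    ← Real.sqrt_mul (by positivity)]
  refine Real.le_sqrt_of_sq_le ?_
  rw [norm_sq_eq, mul_assoc (2 * C.μ₁)]
  refine mul_le_mul_of_nonneg_left ?_ h0
  calc ∑ i, ∑ j, ‖u.symGrad i j‖ ^ 2
      ≤ ∑ _i : Fin n, ∑ _j : Fin n,
          ‖(u.1 : (Fin n → L2 C) × (Fin n → Fin n → L2 C))‖ ^ 2 := by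
        gcongr
        exact u.norm_symGrad_le _ _
    _ = _ := by
        simp
        ring

/-- A closed subspace of a complete space is complete, and the two norm bounds make the identity map
onto it a linear homeomorphism. -/
theorem completeSpace (C : Cell n) : CompleteSpace (Space C) := by
  obtain ⟨K, hK⟩ := exists_norm_pair_le C
  obtain ⟨K', hK'⟩ := exists_norm_le C
  have hc : CompleteSpace (admissible C) := isClosed_admissible.completeSpace_coe
  let e : Space C ≃ₗ[ℂ] admissible C := LinearEquiv.refl ℂ (admissible C)
  let E := e.toContinuousLinearEquivOfBounds K K' hK hK'
  exact (completeSpace_congr (e := E.toEquiv) E.isUniformEmbedding).2 hc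

theorem eq_zero_of_form_self {u : Space C} (h : form u u = 0) : u = 0 := by
  obtain ⟨K, hK⟩ := exists_norm_pair_le C
  have h1 : ‖u‖ ^ 2 = 0 := by
    rw [← inner_self_eq_norm_sq (𝕜 := ℂ)]
    change (form u u).re = 0
    rw [h, Complex.zero_re]
  have h2 := hK u
  rw [pow_eq_zero_iff two_ne_zero |>.1 h1, mul_zero] at h2
  exact Subtype.ext (norm_le_zero_iff.1 h2)

end Space

end Completeness

/-! ### The operator -/

namespace Space

variable {C : Cell n}

/-- Restriction of square integrable functions to the inclusion. -/
def restrictInclusion (C : Cell n) :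
    L2 C →L[ℂ] Lp ℂ 2 ((volume.restrict (C.Q₁ ∪ C.Q₂)).restrict C.Q₂) :=
  LpToLpRestrictCLM (Pt n) ℂ ℂ (volume.restrict (C.Q₁ ∪ C.Q₂)) 2 C.Q₂

theorem norm_restrictInclusion_le (f : L2 C) : ‖restrictInclusion C f‖ ≤ ‖f‖ :=
  norm_Lp_toLp_restrict_le C.Q₂ f

/-- Since weighting by `χ₂` amounts to a genuine inner product on `L²(Q₂)`, symmetry, positivity and
Cauchy–Schwarz for `formχ` come from that space. -/
theorem inner_restrictInclusion (f g : L2 C) :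
    inner ℂ (restrictInclusion C g) (restrictInclusion C f) =
      ∫ y in C.Q₁ ∪ C.Q₂, C.Q₂.indicator (fun _ => (1 : ℂ)) y * (f y * conj (g y)) := by
  have h : ∀ y, C.Q₂.indicator (fun _ => (1 : ℂ)) y * (f y * conj (g y)) =
      C.Q₂.indicator (fun y => f y * conj (g y)) y := fun y => by
    by_cases hy : y ∈ C.Q₂ <;> simp [hy]
  simp only [h]
  rw [integral_indicator C.isOpen₂.measurableSet, L2.inner_def]
  refine integral_congr_ae ?_
  filter_upwards [LpToLpRestrictCLM_coeFn ℂ C.Q₂ f, LpToLpRestrictCLM_coeFn ℂ C.Q₂ g] with y hf hg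
  rw [restrictInclusion, hf, hg, RCLike.inner_apply]

theorem formχ_eq (u v : Space C) :
    formχ u v = 2 * (C.μ₁ : ℂ) * ∑ i, ∑ j, inner ℂ (restrictInclusion C (v.symGrad i j))
      (restrictInclusion C (u.symGrad i j)) := by
  have hint : ∀ i j, Integrable (fun y => C.Q₂.indicator (fun _ => (1 : ℂ)) y *
      (u.symGrad i j y * conj (v.symGrad i j y))) (volume.restrict (C.Q₁ ∪ C.Q₂)) := by
    intro i j
    have h := (L2.integrable_inner (𝕜 := ℂ) (v.symGrad i j) (u.symGrad i j)).indicator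
      C.isOpen₂.measurableSet
    refine h.congr (Eventually.of_forall fun y => ?_)
    by_cases hy : y ∈ C.Q₂ <;> simp [hy]
  simp only [inner_restrictInclusion]
  unfold formχ frob
  simp only [mul_assoc _ (C.Q₂.indicator (fun _ => (1 : ℂ)) _)]
  rw [integral_const_mul]
  congr 1
  simp only [Finset.mul_sum]
  rw [integral_finsetSum _ fun i _ => integrable_finsetSum _ fun j _ => hint i j]
  refine Finset.sum_congr rfl fun i _ => ?_
  rw [integral_finsetSum _ fun j _ => hint i j]

theorem formχ_conj_symm (u v : Space C) : conj (formχ v u) = formχ u v := by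
  simp only [formχ_eq, map_mul, map_sum, inner_conj_symm, Complex.conj_ofReal, map_ofNat]

theorem form_conj_symm (u v : Space C) : conj (form v u) = form u v := by
  simp only [form_eq, map_mul, map_sum, inner_conj_symm, Complex.conj_ofReal, map_ofNat]

theorem formχ_add_left (u u' v : Space C) : formχ (u + u') v = formχ u v + formχ u' v := by
  simp only [formχ_eq, symGrad_add, map_add, inner_add_right, Finset.sum_add_distrib, mul_add]

theorem formχ_smul_left (c : ℂ) (u v : Space C) : formχ (c • u) v = c * formχ u v := by
  simp only [formχ_eq, symGrad_smul, map_smul, inner_smul_right, ← Finset.mul_sum]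
  ring

theorem formχ_add_right (u v v' : Space C) : formχ u (v + v') = formχ u v + formχ u v' := by
  simp only [← formχ_conj_symm u, formχ_add_left, map_add]

theorem formχ_smul_right (c : ℂ) (u v : Space C) : formχ u (c • v) = conj c * formχ u v := by
  simp only [← formχ_conj_symm u, formχ_smul_left, map_mul]

theorem formχ_self (u : Space C) :
    formχ u u = (2 * C.μ₁ * ∑ i, ∑ j, ‖restrictInclusion C (u.symGrad i j)‖ ^ 2 : ℝ) := by
  simp only [formχ_eq, inner_self_eq_norm_sq_to_K]
  push_cast
  rfl

/-- Cauchy–Schwarz in `L²` for each entry, contractivity of restriction, then Cauchy–Schwarz for the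
sum over entries. No constant is lost, which is what yields `‖Γ‖ ≤ 1`. -/
theorem norm_formχ_le (u v : Space C) : ‖formχ u v‖ ≤ ‖u‖ * ‖v‖ := by
  have h0 : 0 ≤ 2 * C.μ₁ := by linarith [C.μ₁_pos]
  have hn : ∀ w : Space C,
      ‖w‖ = √(2 * C.μ₁) * √(∑ p : Fin n × Fin n, ‖w.symGrad p.1 p.2‖ ^ 2) := by
    intro w
    rw [← Real.sqrt_mul h0, Fintype.sum_prod_type, ← norm_sq_eq, Real.sqrt_sq (norm_nonneg w)]
  have h1 : ∀ i j, ‖inner ℂ (restrictInclusion C (v.symGrad i j))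
      (restrictInclusion C (u.symGrad i j))‖ ≤ ‖u.symGrad i j‖ * ‖v.symGrad i j‖ := fun i j =>
    (norm_inner_le_norm _ _).trans <| by
      rw [mul_comm]
      exact mul_le_mul (norm_restrictInclusion_le _) (norm_restrictInclusion_le _)
        (norm_nonneg _) (norm_nonneg _)
  have h2 : ‖formχ u v‖ ≤
      2 * C.μ₁ * ∑ p : Fin n × Fin n, ‖u.symGrad p.1 p.2‖ * ‖v.symGrad p.1 p.2‖ := by
    rw [formχ_eq, ← Fintype.sum_prod_type', norm_mul, norm_mul, Complex.norm_ofNat,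
      Complex.norm_real, Real.norm_of_nonneg C.μ₁_pos.le]
    exact mul_le_mul_of_nonneg_left
      ((norm_sum_le _ _).trans (Finset.sum_le_sum fun p _ => h1 p.1 p.2)) h0
  refine h2.trans ((mul_le_mul_of_nonneg_left (Real.sum_mul_le_sqrt_mul_sqrt _ _ _) h0).trans_eq ?_)
  rw [hn u, hn v]
  -- The weight `2 μ₁` is split into two square roots, one for each norm.
  nth_rewrite 1 [← Real.mul_self_sqrt h0]
  ring

/-- The form `(u, v) ↦ ∫_Q 2 μ₁ χ₂ e(v) : conj (e(u))` as a bounded sesquilinear form. -/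
def sesqχ (C : Cell n) : Space C →L⋆[ℂ] Space C →L[ℂ] ℂ :=
  LinearMap.mkContinuous₂
    (LinearMap.mk₂'ₛₗ (starRingEnd ℂ) (RingHom.id ℂ) (fun u v : Space C => formχ v u)
      (fun u u' v => formχ_add_right v u u') (fun c u v => formχ_smul_right c v u)
      (fun u v v' => formχ_add_left v v' u) (fun c u v => formχ_smul_left c v u)) 1
    fun u v => by
      rw [one_mul, mul_comm]
      exact norm_formχ_le v u

/-- The form `formχ` is represented by a bounded operator. -/
theorem exists_operator (C : Cell n) :
    ∃ T : Space C →L[ℂ] Space C, ∀ u v, form (T u) v = formχ u v := by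
  -- Riesz representation needs a norm; definiteness of the form upgrades the seminorm to one.
  let _ : NormedAddCommGroup (Space C) := NormedAddCommGroup.ofSeparation fun u hu =>
    eq_zero_of_form_self (by
      have h : form u u = inner ℂ u u := rfl
      rw [h, inner_self_eq_norm_sq_to_K, hu]
      simp)
  have := completeSpace C
  refine ⟨InnerProductSpace.continuousLinearMapOfBilin (sesqχ C), fun u v => ?_⟩
  have h := InnerProductSpace.continuousLinearMapOfBilin_apply (sesqχ C) u v
  change form v _ = formχ v u at h
  -- Because `inner ℂ u v` is `form v u`, the representation comes with its slots exchanged;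
  -- conjugation restores the order.
  rw [← form_conj_symm, ← formχ_conj_symm, h]

end Space

end TwoFluid

end

theorem mainTheorem8 (n : ℕ) (hn : n = 2 ∨ n = 3) (C : TwoFluid.Cell n) :
    (∀ u : TwoFluid.Space C, TwoFluid.Space.form u u = 0 → u = 0) ∧
    CompleteSpace (TwoFluid.Space C) ∧
    ∃ Γ : TwoFluid.Space C →L[ℂ] TwoFluid.Space C,
      (∀ u v, TwoFluid.Space.form (Γ u) v = TwoFluid.Space.formχ u v) ∧
      (∀ T : TwoFluid.Space C → TwoFluid.Space C,
        (∀ u v, TwoFluid.Space.form (T u) v = TwoFluid.Space.formχ u v) → ∀ u, T u = Γ u) ∧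
      (∀ u v, TwoFluid.Space.form (Γ u) v = TwoFluid.Space.form u (Γ v)) ∧
      (∀ u, 0 ≤ (TwoFluid.Space.form (Γ u) u).re ∧ (TwoFluid.Space.form (Γ u) u).im = 0) ∧
      ‖Γ‖ ≤ 1 := by
  obtain ⟨Γ, hΓ⟩ := TwoFluid.Space.exists_operator C
  refine ⟨fun u => TwoFluid.Space.eq_zero_of_form_self, TwoFluid.Space.completeSpace C, Γ, hΓ,
    fun T hT u => ?_, fun u v => ?_, fun u => ?_, ?_⟩
  -- `T u` and `Γ u` have the same form against every vector, in particular against their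
  -- difference. Linearity of `T` is not required.
  · rw [← sub_eq_zero]
    refine TwoFluid.Space.eq_zero_of_form_self ?_
    change inner ℂ (T u - Γ u) (T u - Γ u) = 0
    rw [inner_sub_right, sub_eq_zero]
    exact (hT u _).trans (hΓ u _).symm
  · rw [hΓ, ← TwoFluid.Space.form_conj_symm, hΓ, TwoFluid.Space.formχ_conj_symm]
  · rw [hΓ, TwoFluid.Space.formχ_self, Complex.ofReal_re, Complex.ofReal_im]
    have := C.μ₁_pos
    exact ⟨by positivity, rfl⟩
  · refine ContinuousLinearMap.opNorm_le_bound _ zero_le_one fun u => ?_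
    -- The defining identity with `v = Γ u` gives `‖Γ u‖² = formχ u (Γ u)`.
    have h : ‖Γ u‖ ^ 2 ≤ ‖u‖ * ‖Γ u‖ := by
      refine le_trans ?_ (TwoFluid.Space.norm_formχ_le u (Γ u))
      rw [← hΓ, ← inner_self_eq_norm_sq (𝕜 := ℂ)]
      exact Complex.re_le_norm _
    rw [one_mul]
    -- Arguing by contradiction makes `‖Γ u‖` positive, so one factor of it can be cancelled.
    by_contra! hlt
    nlinarith [norm_nonneg u]
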